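/- Let $d\geq 1$, let $M_d(\mathbb{R})$ be the space of real $d\times d$ matrices, and let $\|\cdot\|$ be the operator norm on it induced by the Euclidean norm of $\mathbb{R}^d$. Let $\mathcal{M}_d$ be the set of all Borel probability measures on the closed unit ball of $M_d(\mathbb{R})$, equipped with the weak-* topology, i.e. the smallest topology for which $\mu\mapsto\int f\,d\mu$ is continuous for every continuous real-valued function $f$ on the closed unit ball. For every $\mu\in\mathcal{M}_d$ (regarded as a measure on $M_d(\mathbb{R})$) and every $s>0$ the limit \[\mathbf{M}(\mu,s):=\lim_{n\to\infty}\frac1n\log\left(\int\|A_1\cdots A_n\|^s\,d\mu(A_1)\cdots d\mu(A_n)\right)\] (with the convention $\log 0:=-\infty$) exists in $[-\infty,+\infty)$, and the function $\mathbf{M}\colon\mathcal{M}_d\times(0,+\infty)\to[-\infty,+\infty)$, called the norm pressure, is continuous. -/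

import Mathlib

open MeasureTheory Filter Topology
open scoped ENNReal Matrix.Norms.L2Operator

namespace NormPressure

/-- The space `M_d(ℝ)`. The norm in force is the operator norm induced by the
Euclidean norm on `ℝ^d`. -/
abbrev Mat (d : ℕ) : Type := Matrix (Fin d) (Fin d) ℝ

/-- `M_d(ℝ)` carries its Borel σ-algebra. -/
instance instMeasurableSpaceMat (d : ℕ) : MeasurableSpace (Mat d) := borel (Mat d)

instance instBorelSpaceMat (d : ℕ) : BorelSpace (Mat d) := ⟨rfl⟩

/-- The `n`-fold integral `∫ ‖A₁ ⋯ Aₙ‖ ^ s dμ(A₁) … dμ(Aₙ)`, with values in `[0, ∞]`. -/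
noncomputable def normMoment {d : ℕ} (μ : Measure (Mat d)) (s : ℝ) (n : ℕ) : ℝ≥0∞ :=
  ∫⁻ A : Fin n → Mat d, ENNReal.ofReal (‖(List.ofFn A).prod‖ ^ s) ∂(Measure.pi fun _ => μ)

/-- The sequence `(1 / n) log ∫ ‖A₁ ⋯ Aₙ‖ ^ s dμ(A₁) … dμ(Aₙ)` in `[-∞, ∞]`, where
`log 0 = -∞`. -/
noncomputable def pressureSeq {d : ℕ} (μ : Measure (Mat d)) (s : ℝ) (n : ℕ) : EReal :=
  ((1 / (n : ℝ) : ℝ) : EReal) * ENNReal.log (normMoment μ s n)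

/-- The norm pressure `𝐌(μ, s)`, the limit of `pressureSeq μ s`. -/
noncomputable def pressure {d : ℕ} (μ : Measure (Mat d)) (s : ℝ) : EReal :=
  limUnder atTop (pressureSeq μ s)

/-- The closed unit ball of `M_d(ℝ)`. -/
abbrev UnitBall (d : ℕ) : Type := Metric.closedBall (0 : Mat d) 1

/-- Borel probability measures on the closed unit ball of `M_d(ℝ)`; the topology on
`ProbabilityMeasure` is that of weak convergence, which on this compact space is the
weak-* topology. -/
abbrev BallMeasure (d : ℕ) : Type := ProbabilityMeasure (UnitBall d)

/-- A measure on the closed unit ball, regarded as a measure on `M_d(ℝ)`. -/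
noncomputable def BallMeasure.extend {d : ℕ} (μ : BallMeasure d) : Measure (Mat d) :=
  (μ : Measure (UnitBall d)).map Subtype.val

end NormPressure

namespace NormPressure

/-! Write `u n` for the `n`-th moment. It is submultiplicative and, for fixed `n`, jointly
continuous in the measure and the exponent. Fekete's lemma therefore gives the limit as an infimum
of continuous functions, so the limit exists and is upper semicontinuous.

Lower semicontinuity rests on a Bochi-type inequality, `moment_convPow_mul_le`: if `u N ≤ t ^ N` for
a single `N ≥ 1`, then `u (n * d) ≤ C * t ^ n * u n ^ (d - 1)` for all `n`, where `C` depends only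
on `d` and an upper bound for `s`. If the pressure exceeds `c` at a point, this inequality with `t =
e ^ c` fails there for some `n` (`exists_mul_lt_of_lt_growthRate`). That failure is an open
condition, and wherever it holds every `N ≥ 1` has `u N > e ^ (c N)`, so the pressure is at least
`c`.

For the inequality itself, the hypothesis on `N` yields a function `f` on `ℝ^d`, the `s`-th power of
a quasi-norm up to constants, whose average under `μ` grows at most by the factor `t`. In an
orthonormal basis along which `f` nearly increases (`exists_adapted_orthonormalBasis`), the entries
of an `n`-fold product on and below the diagonal have moments of order `t ^ n`. A path of `d` steps
among `d` indices cannot increase strictly at each step, so each term in a product of `d` such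
blocks contains one of these small entries (`entryMoment_convPow_le`). -/

/-- The `n`-th multiplicative convolution power of a measure on `M_d(ℝ)`. -/
noncomputable def convPow {d : ℕ} (μ : Measure (Mat d)) : ℕ → Measure (Mat d)
  | 0 => Measure.dirac 1
  | n + 1 => μ.mconv (convPow μ n)

/-- The moment `∫ ‖A‖ ^ s dν`. -/
noncomputable def moment {d : ℕ} (ν : Measure (Mat d)) (s : ℝ) : ℝ≥0∞ :=
  ∫⁻ A, ‖A‖ₑ ^ s ∂ν

/-! ### Moments as integrals against convolution powers; submultiplicativity. -/

section ConvPow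

variable {d : ℕ}

instance : SecondCountableTopology (Mat d) :=
  inferInstanceAs (SecondCountableTopology (Fin d → Fin d → ℝ))

instance : MeasurableMul₂ (Mat d) := ⟨(continuous_fst.mul continuous_snd).measurable⟩

variable (μ : Measure (Mat d)) [IsProbabilityMeasure μ]

instance (n : ℕ) : IsProbabilityMeasure (convPow μ n) := by
  induction n with
  | zero => unfold convPow; infer_instance
  | succ n ih => unfold convPow; infer_instance

lemma convPow_add (m n : ℕ) :
    convPow μ (m + n) = (convPow μ m).mconv (convPow μ n) := by
  induction m with
  | zero => simp [convPow]
  | succ m ih =>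
    rw [Nat.succ_add, convPow, ih, convPow, Measure.mconv_assoc]

lemma convPow_one : convPow μ 1 = μ := by
  simp [convPow]

lemma convPow_convPow (m n : ℕ) : convPow (convPow μ m) n = convPow μ (m * n) := by
  induction n with
  | zero => rfl
  | succ n ih => rw [convPow, ih, Nat.mul_succ, Nat.add_comm, convPow_add]

lemma continuous_ofFn_prod (n : ℕ) :
    Continuous fun A : Fin n → Mat d => (List.ofFn A).prod := by
  induction n with
  | zero => simpa using continuous_const
  | succ n ih =>
    simp only [List.ofFn_succ, List.prod_cons]
    exact (continuous_apply 0).mul (ih.comp (continuous_pi fun i => continuous_apply i.succ))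

lemma measurable_ofFn_prod (n : ℕ) :
    Measurable fun A : Fin n → Mat d => (List.ofFn A).prod :=
  (continuous_ofFn_prod n).measurable

lemma map_ofFn_prod (n : ℕ) :
    (Measure.pi fun _ : Fin n => μ).map (fun A => (List.ofFn A).prod) = convPow μ n := by
  induction n with
  | zero =>
    simp only [List.ofFn_zero, List.prod_nil, Measure.map_const, convPow]
    simp
  | succ n ih =>
    have e := measurePreserving_piFinSuccAbove (fun _ : Fin (n + 1) => μ) 0
    have h1 : (fun A : Fin (n + 1) → Mat d => (List.ofFn A).prod) =
        (fun x : Mat d × Mat d => x.1 * x.2) ∘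
          (Prod.map id fun A : Fin n → Mat d => (List.ofFn A).prod) ∘
            MeasurableEquiv.piFinSuccAbove (fun _ => Mat d) 0 := by
      ext A : 1
      simp [List.ofFn_succ, MeasurableEquiv.piFinSuccAbove, Fin.insertNthEquiv]
      rfl
    have hp : Measurable (Prod.map (id : Mat d → Mat d)
        fun A : Fin n → Mat d => (List.ofFn A).prod) :=
      measurable_id.prodMap (measurable_ofFn_prod n)
    rw [h1, ← Measure.map_map measurable_mul (hp.comp e.measurable),
      ← Measure.map_map hp e.measurable, e.map_eq,
      ← Measure.map_prod_map _ _ measurable_id (measurable_ofFn_prod n), ih, Measure.map_id]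
    rfl

lemma measurable_enorm_rpow (s : ℝ) : Measurable fun A : Mat d => ‖A‖ₑ ^ s :=
  (continuous_enorm.measurable).pow_const s

lemma normMoment_eq_moment {s : ℝ} (hs : 0 ≤ s) (n : ℕ) :
    normMoment μ s n = moment (convPow μ n) s := by
  rw [moment, ← map_ofFn_prod, lintegral_map (measurable_enorm_rpow s) (measurable_ofFn_prod n),
    normMoment]
  refine lintegral_congr fun A => ?_
  rw [← ENNReal.ofReal_rpow_of_nonneg (norm_nonneg _) hs, ofReal_norm]

lemma moment_mconv_le (ν ν' : Measure (Mat d)) [SFinite ν] [SFinite ν'] {s : ℝ} (hs : 0 ≤ s) :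
    moment (ν.mconv ν') s ≤ moment ν s * moment ν' s := by
  rw [moment, Measure.lintegral_mconv (measurable_enorm_rpow s), moment,
    ← lintegral_mul_const _ (measurable_enorm_rpow s)]
  refine lintegral_mono fun A => ?_
  simp only [moment]
  rw [← lintegral_const_mul _ (measurable_enorm_rpow s)]
  refine lintegral_mono fun B => ?_
  simp only
  rw [← ENNReal.mul_rpow_of_nonneg _ _ hs]
  refine ENNReal.rpow_le_rpow ?_ hs
  rw [← ofReal_norm, ← ofReal_norm, ← ofReal_norm, ← ENNReal.ofReal_mul (norm_nonneg _)]
  exact ENNReal.ofReal_le_ofReal (norm_mul_le A B)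

lemma moment_convPow_add_le {s : ℝ} (hs : 0 ≤ s) (m n : ℕ) :
    moment (convPow μ (m + n)) s ≤ moment (convPow μ m) s * moment (convPow μ n) s := by
  rw [convPow_add]
  exact moment_mconv_le _ _ hs

end ConvPow

/-- The sum is at most the cardinality times its largest term. The constant uses `S` in place of `s`
so that it stays uniform over all exponents up to `S`. -/
lemma sum_rpow_le {ι : Type*} [Fintype ι] {s S : ℝ} (hs : 0 < s) (hS : s ≤ S) (x : ι → ℝ≥0∞) :
    (∑ i, x i) ^ s ≤ (Fintype.card ι : ℝ≥0∞) ^ S * ∑ i, x i ^ s := by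
  cases isEmpty_or_nonempty ι
  · simp [hs]
  obtain ⟨m, -, hm⟩ := Finset.exists_max_image Finset.univ x Finset.univ_nonempty
  have hc : (1 : ℝ≥0∞) ≤ Fintype.card ι := by exact_mod_cast Fintype.card_pos
  calc (∑ i, x i) ^ s ≤ (Fintype.card ι * x m) ^ s := by
        refine ENNReal.rpow_le_rpow ?_ hs.le
        simpa using Finset.sum_le_card_nsmul Finset.univ x (x m) hm
    _ = (Fintype.card ι : ℝ≥0∞) ^ s * x m ^ s := ENNReal.mul_rpow_of_nonneg _ _ hs.le
    _ ≤ _ := mul_le_mul' (ENNReal.rpow_le_rpow_of_exponent_le hc hS)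
        (Finset.single_le_sum (f := fun i => x i ^ s) (fun _ _ => zero_le) (Finset.mem_univ m))

lemma add_rpow_le {s S : ℝ} (hs : 0 < s) (hS : s ≤ S) (x y : ℝ≥0∞) :
    (x + y) ^ s ≤ 2 ^ S * (x ^ s + y ^ s) := by
  simpa using sum_rpow_le hs hS ![x, y]

/-! ### Orthonormal bases adapted to a quasi-norm. -/

section Greedy

variable {E : Type*} [NormedAddCommGroup E] [InnerProductSpace ℝ E]

lemma exists_norm_eq_one_inner_eq_zero (u : ℕ → E) {k : ℕ} (hk : k < Module.finrank ℝ E) :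
    ∃ x : E, ‖x‖ = 1 ∧ ∀ j < k, inner ℝ (u j) x = 0 := by
  classical
  set W := Submodule.span ℝ ((Finset.range k).image u : Set E) with hW
  have h1 : Module.finrank ℝ W ≤ k := by
    refine (finrank_span_finset_le_card _).trans ?_
    exact Finset.card_image_le.trans (by simp)
  have h2 : Wᗮ ≠ ⊥ := by
    intro h
    rw [Submodule.orthogonal_eq_bot_iff] at h
    rw [h, finrank_top] at h1
    omega
  obtain ⟨x, hx, hx0⟩ := Submodule.exists_mem_ne_zero_of_ne_bot h2
  refine ⟨(‖x‖⁻¹ : ℝ) • x, norm_smul_inv_norm hx0, fun j hj => ?_⟩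
  rw [inner_smul_right, (Submodule.mem_orthogonal W x).1 hx (u j), mul_zero]
  exact Submodule.subset_span (by simpa using ⟨j, hj, rfl⟩)

/-- Orthonormal vectors chosen successively so as to nearly minimise a positive
`s`-homogeneous function on the orthogonal complement of their predecessors. -/
lemma exists_greedy_orthonormal {s : ℝ} (hs : 0 < s) (f : E → ℝ≥0∞) (hfin : ∀ x, f x ≠ ⊤)
    (hpos : ∀ x, ‖x‖ₑ ^ s ≤ f x) (hsmul : ∀ (c : ℝ) x, f (c • x) = ‖c‖ₑ ^ s * f x) (k : ℕ)
    (hk : k ≤ Module.finrank ℝ E) :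
    ∃ u : ℕ → E, (∀ i < k, ‖u i‖ = 1) ∧ (∀ i < k, ∀ j < i, inner ℝ (u j) (u i) = 0) ∧
      ∀ i < k, ∀ x, (∀ j < i, inner ℝ (u j) x = 0) → ‖x‖ₑ ^ s * f (u i) ≤ 2 * f x := by
  induction k with
  | zero => exact ⟨fun _ => 0, by simp⟩
  | succ k ih =>
    obtain ⟨u, h1, h2, h3⟩ := ih (by omega)
    obtain ⟨x₀, hx₀⟩ := exists_norm_eq_one_inner_eq_zero u (k := k) (by omega)
    set T : Set E := {x | ‖x‖ = 1 ∧ ∀ j < k, inner ℝ (u j) x = 0}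
    set I := ⨅ x ∈ T, f x
    have hI1 : 1 ≤ I := le_iInf₂ fun x hx => by
      have := hpos x
      rwa [← ofReal_norm, hx.1, ENNReal.ofReal_one, ENNReal.one_rpow] at this
    have hI2 : I ≠ ⊤ := ne_top_of_le_ne_top (hfin x₀) (iInf₂_le x₀ hx₀)
    -- The factor 2 leaves room to pick a vector near the infimum without continuity of `f`;
    -- strictness needs `1 ≤ I < ⊤`.
    have hI : I < 2 * I := by
      rw [two_mul]
      exact ENNReal.lt_add_right hI2 (by positivity)
    obtain ⟨y, hy, hyI⟩ : ∃ y ∈ T, f y < 2 * I := by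
      have := hI
      simp only [I, iInf_lt_iff] at this
      obtain ⟨y, hy, h⟩ := this
      exact ⟨y, hy, h⟩
    have hu : ∀ j < k, Function.update u k y j = u j := fun j hj =>
      Function.update_of_ne hj.ne _ _
    refine ⟨Function.update u k y, ?_, ?_, ?_⟩
    · intro i hi
      rcases Nat.lt_succ_iff_lt_or_eq.1 hi with h | rfl
      · rw [hu i h, h1 i h]
      · simpa using hy.1
    · intro i hi j hj
      rcases Nat.lt_succ_iff_lt_or_eq.1 hi with h | rfl
      · rw [hu i h, hu j (hj.trans h), h2 i h j hj]
      · rw [hu j hj]; simpa using hy.2 j hj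
    · intro i hi x hx
      rcases Nat.lt_succ_iff_lt_or_eq.1 hi with h | rfl
      · rw [hu i h]
        exact h3 i h x fun j hj => by rw [← hu j (hj.trans h)]; exact hx j hj
      · rw [Function.update_self]
        by_cases hx0 : x = 0
        · simp [hx0, hs]
        have hT : ((‖x‖⁻¹ : ℝ) • x) ∈ T := by
          refine ⟨norm_smul_inv_norm hx0, fun j hj => ?_⟩
          rw [inner_smul_right, ← hu j hj, hx j hj, mul_zero]
        calc ‖x‖ₑ ^ s * f y ≤ ‖x‖ₑ ^ s * (2 * f ((‖x‖⁻¹ : ℝ) • x)) := by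
              gcongr
              exact hyI.le.trans (by gcongr; exact iInf₂_le _ hT)
          _ = 2 * f (‖x‖ • (‖x‖⁻¹ : ℝ) • x) := by
              rw [hsmul ‖x‖, enorm_norm]; ring
          _ = 2 * f x := by
              rw [smul_smul, mul_inv_cancel₀ (norm_ne_zero_iff.2 hx0), one_smul]

/-- An orthonormal basis adapted to a quasi-norm, with comparison constants depending only on the
quasi-triangle constant and the dimension. -/
lemma exists_adapted_orthonormalBasis [FiniteDimensional ℝ E] {d : ℕ} (hd : Module.finrank ℝ E = d) {s : ℝ} (hs : 0 < s)
    {K : ℝ≥0∞} (hK : 1 ≤ K)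
    (f : E → ℝ≥0∞) (hfin : ∀ x, f x ≠ ⊤)
    (hpos : ∀ x, ‖x‖ₑ ^ s ≤ f x) (hsmul : ∀ (c : ℝ) x, f (c • x) = ‖c‖ₑ ^ s * f x)
    (hadd : ∀ x y, f (x + y) ≤ K * (f x + f y)) :
    ∃ b : OrthonormalBasis (Fin d) ℝ E, (∀ i j, i ≤ j → f (b i) ≤ 2 * f (b j)) ∧
      ∀ i x, ‖(inner ℝ (b i) x : ℝ)‖ₑ ^ s * f (b i) ≤ 2 * (3 * K) ^ d * f x := by
  obtain ⟨u, h1, h2, h3⟩ := exists_greedy_orthonormal hs f hfin hpos hsmul d hd.ge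
  have horth : ∀ i < d, ∀ j < d, i ≠ j → inner ℝ (u i) (u j) = 0 := by
    intro i hi j hj hij
    rcases lt_or_gt_of_ne hij with h | h
    · exact h2 j hj i h
    · rw [real_inner_comm]; exact h2 i hi j h
  have hu : Orthonormal ℝ fun i : Fin d => u i :=
    ⟨fun i => h1 i i.2, fun i j hij => horth i i.2 j j.2 (Fin.val_ne_of_ne hij)⟩
  let b : OrthonormalBasis (Fin d) ℝ E :=
    OrthonormalBasis.mk hu (hu.linearIndependent.span_eq_top_of_card_eq_finrank' (by simp [hd])).ge
  have hb : ∀ i, b i = u i := fun i => by simp [b]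
  refine ⟨b, fun i j hij => ?_, fun i x => ?_⟩
  · rw [hb, hb]
    have := h3 i i.2 (u j) fun l hl =>
      horth l (hl.trans i.2) j j.2 (hl.trans_le hij).ne
    rwa [← ofReal_norm, h1 j j.2, ENNReal.ofReal_one, ENNReal.one_rpow, one_mul] at this
  -- `y k` is what remains of `x` after its first `k` coordinates are removed. It is orthogonal to
  -- the earlier basis vectors, so near-minimality of `u k` bounds the next coordinate by `f (y k)`.
  -- Removing that coordinate costs a factor `K * (1 + 2)`.
  · set y : ℕ → E := fun k => x - ∑ l ∈ Finset.range k, (inner ℝ (u l) x : ℝ) • u l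
    have hy0 : ∀ k ≤ d, ∀ j < k, inner ℝ (u j) (y k) = 0 := by
      intro k hk j hj
      simp only [y, inner_sub_right, inner_sum, inner_smul_right]
      rw [Finset.sum_eq_single_of_mem j (by simpa using hj)
        (fun l hl hne => by
          rw [horth j (by omega) l (by have := Finset.mem_range.1 hl; omega) hne.symm, mul_zero]),
        real_inner_self_eq_norm_sq, h1 j (by omega)]
      ring
    have hyk : ∀ k < d, inner ℝ (u k) (y k) = inner ℝ (u k) x := by
      intro k hk
      simp only [y, inner_sub_right, inner_sum, inner_smul_right]
      rw [Finset.sum_eq_zero, sub_zero]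
      intro l hl
      have := Finset.mem_range.1 hl
      rw [horth k hk l (by omega) (by omega), mul_zero]
    have hcoef : ∀ k < d, ‖(inner ℝ (u k) x : ℝ)‖ₑ ^ s * f (u k) ≤ 2 * f (y k) := by
      intro k hk
      refine le_trans ?_ (h3 k hk (y k) (hy0 k hk.le))
      gcongr
      rw [← hyk k hk, ← ofReal_norm, ← ofReal_norm]
      refine ENNReal.ofReal_le_ofReal ?_
      simpa [h1 k hk] using norm_inner_le_norm (𝕜 := ℝ) (u k) (y k)
    have hgrow : ∀ k ≤ d, f (y k) ≤ (3 * K) ^ k * f x := by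
      intro k hk
      induction k with
      | zero => simp [y]
      | succ k ih =>
        have hstep : y (k + 1) = y k + (-(inner ℝ (u k) x : ℝ)) • u k := by
          simp only [y, Finset.sum_range_succ, neg_smul]; abel
        calc f (y (k + 1)) ≤ K * (f (y k) + ‖(inner ℝ (u k) x : ℝ)‖ₑ ^ s * f (u k)) := by
              rw [hstep]
              refine (hadd _ _).trans_eq ?_
              rw [hsmul, enorm_neg]
          _ ≤ K * (f (y k) + 2 * f (y k)) := mul_le_mul' le_rfl (add_le_add le_rfl (hcoef k hk))
          _ = (3 * K) * f (y k) := by ring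
          _ ≤ (3 * K) * ((3 * K) ^ k * f x) := by gcongr; exact ih (by omega)
          _ = _ := by ring
    rw [hb]
    calc _ ≤ 2 * f (y i) := hcoef i i.2
      _ ≤ 2 * ((3 * K) ^ (i : ℕ) * f x) := by gcongr; exact hgrow i i.2.le
      _ ≤ 2 * ((3 * K) ^ d * f x) := by
          gcongr
          · exact le_mul_of_one_le_of_le (by norm_num) hK
          · exact i.2.le
      _ = _ := by ring

end Greedy

/-! ### Moments of matrix entries in an orthonormal basis. -/

section Entries

variable {d : ℕ}

/-- The action of `M_d(ℝ)` on the Euclidean space `ℝ^d`. -/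
noncomputable abbrev act (A : Mat d) (v : EuclideanSpace ℝ (Fin d)) : EuclideanSpace ℝ (Fin d) :=
  Matrix.toEuclideanCLM (n := Fin d) (𝕜 := ℝ) A v

lemma act_mul (A B : Mat d) (v : EuclideanSpace ℝ (Fin d)) : act (A * B) v = act A (act B v) := by
  simp [act]

lemma norm_act_le (A : Mat d) (v : EuclideanSpace ℝ (Fin d)) : ‖act A v‖ ≤ ‖A‖ * ‖v‖ :=
  ContinuousLinearMap.le_opNorm _ v

lemma continuous_toEuclideanCLM :
    Continuous fun A : Mat d => Matrix.toEuclideanCLM (n := Fin d) (𝕜 := ℝ) A :=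
  LinearMap.continuous_of_finiteDimensional
    (Matrix.toEuclideanCLM (n := Fin d) (𝕜 := ℝ)).toAlgEquiv.toLinearMap

lemma continuous_act : Continuous fun p : Mat d × EuclideanSpace ℝ (Fin d) => act p.1 p.2 :=
  (continuous_toEuclideanCLM.comp continuous_fst).clm_apply continuous_snd

lemma continuous_act_left (v : EuclideanSpace ℝ (Fin d)) : Continuous fun A : Mat d => act A v :=
  continuous_toEuclideanCLM.clm_apply continuous_const

lemma measurable_enorm_act_rpow (s : ℝ) :
    Measurable fun p : Mat d × EuclideanSpace ℝ (Fin d) => ‖act p.1 p.2‖ₑ ^ s :=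
  (continuous_enorm.comp continuous_act).measurable.pow_const s

variable (b : OrthonormalBasis (Fin d) ℝ (EuclideanSpace ℝ (Fin d)))

/-- The matrix entries of `A` in the orthonormal basis `b`. -/
noncomputable def entry (i j : Fin d) (A : Mat d) : ℝ := inner ℝ (b i) (act A (b j))

lemma measurable_enorm_entry_rpow (s : ℝ) (i j : Fin d) :
    Measurable fun A : Mat d => ‖entry b i j A‖ₑ ^ s := by
  have h : Continuous fun A : Mat d => entry b i j A :=
    Continuous.inner (𝕜 := ℝ) continuous_const (continuous_act_left (b j))
  exact (continuous_enorm.comp h).measurable.pow_const s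

lemma enorm_entry_le (i j : Fin d) (A : Mat d) : ‖entry b i j A‖ₑ ≤ ‖A‖ₑ := by
  rw [← ofReal_norm, ← ofReal_norm]
  refine ENNReal.ofReal_le_ofReal ?_
  calc ‖entry b i j A‖ ≤ ‖b i‖ * ‖act A (b j)‖ := norm_inner_le_norm _ _
    _ ≤ ‖b i‖ * (‖A‖ * ‖b j‖) := by gcongr; exact norm_act_le _ _
    _ = ‖A‖ := by simp

lemma entry_mul (i j : Fin d) (A B : Mat d) :
    entry b i j (A * B) = ∑ l, entry b i l A * entry b l j B := by
  unfold entry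
  rw [act_mul]
  conv_lhs => rw [← b.sum_repr' (act B (b j))]
  simp only [act, map_sum, map_smul, inner_sum, inner_smul_right]
  exact Finset.sum_congr rfl fun l _ => mul_comm _ _

lemma enorm_le_sum_entry (A : Mat d) : ‖A‖ₑ ≤ ∑ p : Fin d × Fin d, ‖entry b p.1 p.2 A‖ₑ := by
  have h : ‖A‖ ≤ ∑ p : Fin d × Fin d, ‖entry b p.1 p.2 A‖ := by
    refine ContinuousLinearMap.opNorm_le_bound _ (by positivity) fun v => ?_
    have hv : act A v = ∑ j, ∑ i, ((inner ℝ (b j) v : ℝ) * entry b i j A) • b i := by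
      conv_lhs => rw [← b.sum_repr' v]
      simp only [act, map_sum, map_smul]
      refine Finset.sum_congr rfl fun j _ => ?_
      conv_lhs => rw [← b.sum_repr' (Matrix.toEuclideanCLM (n := Fin d) (𝕜 := ℝ) A (b j))]
      simp only [Finset.smul_sum, smul_smul]
      rfl
    change ‖act A v‖ ≤ _
    rw [hv, Finset.sum_mul, Fintype.sum_prod_type_right]
    refine (norm_sum_le _ _).trans (Finset.sum_le_sum fun j _ => ?_)
    refine (norm_sum_le _ _).trans (Finset.sum_le_sum fun i _ => ?_)
    rw [norm_smul, norm_mul, b.norm_eq_one, mul_one, mul_comm]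
    gcongr
    simpa using norm_inner_le_norm (𝕜 := ℝ) (b j) v
  rw [← ofReal_norm]
  refine (ENNReal.ofReal_le_ofReal h).trans_eq ?_
  rw [ENNReal.ofReal_sum_of_nonneg fun _ _ => norm_nonneg _]
  simp only [ofReal_norm]

/-- The moments of the matrix entries. -/
noncomputable def entryMoment (ν : Measure (Mat d)) (s : ℝ) (i j : Fin d) : ℝ≥0∞ :=
  ∫⁻ A, ‖entry b i j A‖ₑ ^ s ∂ν

lemma entryMoment_le_moment (ν : Measure (Mat d)) {s : ℝ} (hs : 0 ≤ s) (i j : Fin d) :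
    entryMoment b ν s i j ≤ moment ν s :=
  lintegral_mono fun A => ENNReal.rpow_le_rpow (enorm_entry_le b i j A) hs

lemma entryMoment_mconv_le (ν ν' : Measure (Mat d)) [SFinite ν] [SFinite ν'] {s S : ℝ}
    (hs : 0 < s) (hS : s ≤ S) (i j : Fin d) :
    entryMoment b (ν.mconv ν') s i j ≤
      (d : ℝ≥0∞) ^ S * ∑ l, entryMoment b ν s i l * entryMoment b ν' s l j := by
  have hm := measurable_enorm_entry_rpow b s
  have key : ∀ A B : Mat d, ‖entry b i j (A * B)‖ₑ ^ s ≤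
      (d : ℝ≥0∞) ^ S * ∑ l, ‖entry b i l A‖ₑ ^ s * ‖entry b l j B‖ₑ ^ s := by
    intro A B
    rw [entry_mul]
    refine (ENNReal.rpow_le_rpow (enorm_sum_le _ _) hs.le).trans ?_
    refine (sum_rpow_le hs hS _).trans_eq ?_
    simp only [Fintype.card_fin, enorm_mul, ENNReal.mul_rpow_of_nonneg _ _ hs.le]
  rw [entryMoment, Measure.lintegral_mconv (hm i j)]
  calc _ ≤ ∫⁻ A, ∫⁻ B, (d : ℝ≥0∞) ^ S *
        ∑ l, ‖entry b i l A‖ₑ ^ s * ‖entry b l j B‖ₑ ^ s ∂ν' ∂ν :=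
        lintegral_mono fun A => lintegral_mono fun B => key A B
    _ = ∫⁻ A, (d : ℝ≥0∞) ^ S *
        ∑ l, ‖entry b i l A‖ₑ ^ s * entryMoment b ν' s l j ∂ν := by
        refine lintegral_congr fun A => ?_
        rw [lintegral_const_mul _
          (Finset.measurable_sum _ fun l _ => (hm l j).const_mul _),
          lintegral_finsetSum _ fun l _ => (hm l j).const_mul _]
        congr 1
        exact Finset.sum_congr rfl fun l _ => lintegral_const_mul _ (hm l j)
    _ = _ := by
        rw [lintegral_const_mul _
          (Finset.measurable_sum _ fun l _ => (hm i l).mul_const _),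
          lintegral_finsetSum _ fun l _ => (hm i l).mul_const _]
        congr 1
        exact Finset.sum_congr rfl fun l _ => lintegral_mul_const _ (hm i l)

lemma moment_le_sum_entryMoment (ν : Measure (Mat d)) {s S : ℝ} (hs : 0 < s) (hS : s ≤ S) :
    moment ν s ≤ ((d * d : ℕ) : ℝ≥0∞) ^ S * ∑ p : Fin d × Fin d, entryMoment b ν s p.1 p.2 := by
  have hm := measurable_enorm_entry_rpow b s
  calc moment ν s ≤ ∫⁻ A, ((d * d : ℕ) : ℝ≥0∞) ^ S *
        ∑ p : Fin d × Fin d, ‖entry b p.1 p.2 A‖ₑ ^ s ∂ν := by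
        refine lintegral_mono fun A => ?_
        refine (ENNReal.rpow_le_rpow (enorm_le_sum_entry b A) hs.le).trans ?_
        simpa using sum_rpow_le hs hS fun p : Fin d × Fin d => ‖entry b p.1 p.2 A‖ₑ
    _ = _ := by
        rw [lintegral_const_mul _ (Finset.measurable_sum _ fun p _ => hm p.1 p.2),
          lintegral_finsetSum _ fun p _ => hm p.1 p.2]
        rfl

/-- If the entries of `ν` on and below the diagonal have small moments, then so does the `d`-th
convolution power of `ν`: an index path of length `d` cannot be strictly increasing. -/
lemma entryMoment_convPow_le (ν : Measure (Mat d)) [IsProbabilityMeasure ν] {s S : ℝ}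
    (hs : 0 < s) (hS : s ≤ S) {p : ℝ≥0∞} (hp : ∀ i j, j ≤ i → entryMoment b ν s i j ≤ p)
    (m : ℕ) (i j : Fin d) (hij : (j : ℕ) ≤ i + m) :
    entryMoment b (convPow ν (m + 1)) s i j ≤
      ((d : ℝ≥0∞) ^ S * d) ^ m * p * moment ν s ^ m := by
  have hall : ∀ (m : ℕ) (i j : Fin d), entryMoment b (convPow ν m) s i j ≤ moment ν s ^ m := by
    intro m i j
    refine (entryMoment_le_moment b _ hs.le i j).trans ?_
    induction m with
    | zero =>
      rw [convPow, moment, lintegral_dirac' _ (measurable_enorm_rpow s), pow_zero]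
      have : ‖(1 : Mat d)‖ ≤ 1 := by
        have : Nonempty (Fin d) := ⟨i⟩
        exact CStarRing.norm_one.le
      refine ENNReal.rpow_le_one ?_ hs.le
      rw [← ofReal_norm]
      exact ENNReal.ofReal_le_one.2 this
    | succ m ih =>
      rw [convPow, pow_succ']
      exact (moment_mconv_le _ _ hs.le).trans (by gcongr)
  induction m generalizing i j with
  | zero =>
    rw [zero_add, convPow_one, pow_zero, pow_zero, one_mul, mul_one]
    exact hp i j (by rw [Fin.le_def]; omega)
  | succ m ih =>
    rw [convPow]
    refine (entryMoment_mconv_le b _ _ hs hS i j).trans ?_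
    set D := (d : ℝ≥0∞) ^ S * d with hD
    have h1 : (1 : ℝ≥0∞) ≤ d := by exact_mod_cast i.pos
    have hD1 : 1 ≤ D := one_le_mul (ENNReal.one_le_rpow h1 (hs.trans_le hS)) h1
    have hterm : ∀ l, entryMoment b ν s i l * entryMoment b (convPow ν (m + 1)) s l j ≤
        D ^ m * p * moment ν s ^ (m + 1) := by
      intro l
      -- Either the first step of the path fails to increase and supplies the factor `p`, or `l ≥ i
      -- + 1` and the remaining path from `l` still satisfies `j ≤ l + m`.
      rcases le_or_gt l i with hl | hl
      · calc _ ≤ p * moment ν s ^ (m + 1) := by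
              gcongr
              · exact hp i l hl
              · exact hall _ _ _
          _ ≤ D ^ m * p * moment ν s ^ (m + 1) := by
              gcongr
              exact le_mul_of_one_le_left' (one_le_pow₀ hD1)
      · calc _ ≤ moment ν s * (D ^ m * p * moment ν s ^ m) := by
              gcongr
              · exact entryMoment_le_moment b ν hs.le i l
              · exact ih l j (by rw [Fin.lt_def] at hl; omega)
          _ = _ := by ring
    calc _ ≤ (d : ℝ≥0∞) ^ S * ∑ _l : Fin d, D ^ m * p * moment ν s ^ (m + 1) := by
          exact mul_le_mul' le_rfl (Finset.sum_le_sum fun l _ => hterm l)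
      _ = _ := by
          rw [Finset.sum_const, Finset.card_univ, Fintype.card_fin, nsmul_eq_mul, pow_succ D]
          rw [hD]; ring

end Entries

/-! ### The potential function and the Bochi-type inequality. -/

section Potential

variable {d : ℕ}

/-- The average growth `∫ ‖A v‖ ^ s dν(A)` of a vector. -/
noncomputable def vectorMoment (ν : Measure (Mat d)) (s : ℝ) (v : EuclideanSpace ℝ (Fin d)) :
    ℝ≥0∞ :=
  ∫⁻ A, ‖act A v‖ₑ ^ s ∂ν

/-- A function on `ℝ^d` whose `μ`-average along the action grows at most by the factor `t`. -/
noncomputable def potential (μ : Measure (Mat d)) (s : ℝ) (t : ℝ≥0∞) (N : ℕ)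
    (v : EuclideanSpace ℝ (Fin d)) : ℝ≥0∞ :=
  ∑ n ∈ Finset.range N, t⁻¹ ^ n * vectorMoment (convPow μ n) s v

lemma measurable_act_left (s : ℝ) (v : EuclideanSpace ℝ (Fin d)) :
    Measurable fun A : Mat d => ‖act A v‖ₑ ^ s :=
  (continuous_enorm.comp (continuous_act_left v)).measurable.pow_const s

lemma measurable_vectorMoment (ν : Measure (Mat d)) [SFinite ν] (s : ℝ) :
    Measurable (vectorMoment ν s) :=
  Measurable.lintegral_prod_left' (measurable_enorm_act_rpow s)

lemma measurable_potential (μ : Measure (Mat d)) [IsProbabilityMeasure μ] (s : ℝ) (t : ℝ≥0∞)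
    (N : ℕ) : Measurable (potential μ s t N) :=
  Finset.measurable_sum _ fun _ _ => (measurable_vectorMoment _ s).const_mul _

lemma vectorMoment_le (ν : Measure (Mat d)) {s : ℝ} (hs : 0 ≤ s) (v : EuclideanSpace ℝ (Fin d)) :
    vectorMoment ν s v ≤ moment ν s * ‖v‖ₑ ^ s := by
  rw [moment, ← lintegral_mul_const _ (measurable_enorm_rpow s)]
  refine lintegral_mono fun A => ?_
  rw [← ENNReal.mul_rpow_of_nonneg _ _ hs]
  refine ENNReal.rpow_le_rpow ?_ hs
  rw [← ofReal_norm, ← ofReal_norm, ← ofReal_norm, ← ENNReal.ofReal_mul (norm_nonneg _)]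
  exact ENNReal.ofReal_le_ofReal (norm_act_le A v)

lemma vectorMoment_smul (ν : Measure (Mat d)) {s : ℝ} (hs : 0 ≤ s) (c : ℝ)
    (v : EuclideanSpace ℝ (Fin d)) :
    vectorMoment ν s (c • v) = ‖c‖ₑ ^ s * vectorMoment ν s v := by
  rw [vectorMoment, vectorMoment, ← lintegral_const_mul _ (measurable_act_left s v)]
  refine lintegral_congr fun A => ?_
  rw [act, map_smul, enorm_smul, ENNReal.mul_rpow_of_nonneg _ _ hs]

lemma vectorMoment_add_le (ν : Measure (Mat d)) {s S : ℝ} (hs : 0 < s) (hS : s ≤ S)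
    (v w : EuclideanSpace ℝ (Fin d)) :
    vectorMoment ν s (v + w) ≤ 2 ^ S * (vectorMoment ν s v + vectorMoment ν s w) := by
  rw [vectorMoment, vectorMoment, vectorMoment, ← lintegral_add_left (measurable_act_left s v),
    ← lintegral_const_mul (2 ^ S) (f := fun A : Mat d => ‖act A v‖ₑ ^ s + ‖act A w‖ₑ ^ s)
      ((measurable_act_left s v).add (measurable_act_left s w))]
  refine lintegral_mono fun A => ?_
  refine le_trans ?_ (add_rpow_le hs hS _ _)
  rw [act, map_add]
  exact ENNReal.rpow_le_rpow (enorm_add_le _ _) hs.le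

/-- Here `μ` acts on the vector first, so it is the right-hand factor of the convolution. -/
lemma lintegral_vectorMoment_act (ν μ : Measure (Mat d)) [SFinite ν] [SFinite μ] (s : ℝ)
    (v : EuclideanSpace ℝ (Fin d)) :
    ∫⁻ A, vectorMoment ν s (act A v) ∂μ = vectorMoment (ν.mconv μ) s v := by
  rw [vectorMoment, Measure.mconv, lintegral_map (measurable_act_left s v) measurable_mul,
    lintegral_prod_symm' (fun p : Mat d × Mat d => ‖act (p.1 * p.2) v‖ₑ ^ s)
      ((measurable_act_left s v).comp measurable_mul)]
  simp only [act_mul, vectorMoment]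

lemma enorm_rpow_le_potential (μ : Measure (Mat d)) (s : ℝ) (t : ℝ≥0∞) {N : ℕ} (hN : 1 ≤ N)
    (v : EuclideanSpace ℝ (Fin d)) : ‖v‖ₑ ^ s ≤ potential μ s t N v := by
  refine le_trans (le_of_eq ?_)
    (Finset.single_le_sum (f := fun n => t⁻¹ ^ n * vectorMoment (convPow μ n) s v)
      (fun _ _ => zero_le) (Finset.mem_range.2 hN))
  simp only [pow_zero, one_mul, vectorMoment, convPow]
  rw [lintegral_dirac' _ (measurable_act_left s v)]
  simp [act]

/-- Averaging shifts the sum by one index and brings out a factor `t`. The new last term, of index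
`N`, is absorbed by the lost term of index `0`, which is `‖v‖ₑ ^ s`; this is the only use of the
bound on the `N`-th moment. -/
lemma lintegral_potential_act_le (μ : Measure (Mat d)) [IsProbabilityMeasure μ] {s : ℝ}
    (hs : 0 ≤ s) {t : ℝ≥0∞} (ht : t ≠ 0) (ht' : t ≠ ⊤) {N : ℕ} (hN : 1 ≤ N)
    (h : moment (convPow μ N) s ≤ t ^ N) (v : EuclideanSpace ℝ (Fin d)) :
    ∫⁻ A, potential μ s t N (act A v) ∂μ ≤ t * potential μ s t N v := by
  have hmeas : ∀ n, Measurable fun A : Mat d => vectorMoment (convPow μ n) s (act A v) := fun n =>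
    (measurable_vectorMoment _ s).comp (continuous_act_left _).measurable
  have h1 : ∫⁻ A, potential μ s t N (act A v) ∂μ =
      ∑ n ∈ Finset.range N, t⁻¹ ^ n * vectorMoment (convPow μ (n + 1)) s v := by
    simp only [potential]
    rw [lintegral_finsetSum _ fun n _ => (hmeas n).const_mul _]
    refine Finset.sum_congr rfl fun n _ => ?_
    rw [lintegral_const_mul _ (hmeas n), lintegral_vectorMoment_act, convPow_add, convPow_one]
  have h2 : ∀ n, t⁻¹ ^ n * vectorMoment (convPow μ (n + 1)) s v =
      t * (t⁻¹ ^ (n + 1) * vectorMoment (convPow μ (n + 1)) s v) := fun n => by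
    rw [pow_succ', ← mul_assoc, ← mul_assoc, ENNReal.mul_inv_cancel ht ht', one_mul]
  rw [h1, Finset.sum_congr rfl fun n _ => h2 n, ← Finset.mul_sum]
  gcongr
  obtain ⟨M, rfl⟩ : ∃ M, N = M + 1 := ⟨N - 1, by omega⟩
  rw [Finset.sum_range_succ, potential, Finset.sum_range_succ']
  refine add_le_add le_rfl ?_
  calc t⁻¹ ^ (M + 1) * vectorMoment (convPow μ (M + 1)) s v
      ≤ t⁻¹ ^ (M + 1) * (t ^ (M + 1) * ‖v‖ₑ ^ s) := by
        gcongr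
        exact (vectorMoment_le _ hs v).trans (by gcongr)
    _ = ‖v‖ₑ ^ s := by
        rw [← mul_assoc, ← mul_pow, ENNReal.inv_mul_cancel ht ht', one_pow, one_mul]
    _ = _ := by
        simp only [pow_zero, one_mul, vectorMoment, convPow]
        rw [lintegral_dirac' _ (measurable_act_left s v)]
        simp [act]

lemma lintegral_potential_convPow_le (μ : Measure (Mat d)) [IsProbabilityMeasure μ] {s : ℝ}
    (hs : 0 ≤ s) {t : ℝ≥0∞} (ht : t ≠ 0) (ht' : t ≠ ⊤) {N : ℕ} (hN : 1 ≤ N)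
    (h : moment (convPow μ N) s ≤ t ^ N) (n : ℕ) (v : EuclideanSpace ℝ (Fin d)) :
    ∫⁻ A, potential μ s t N (act A v) ∂(convPow μ n) ≤ t ^ n * potential μ s t N v := by
  have hm : ∀ v, Measurable fun A : Mat d => potential μ s t N (act A v) := fun v =>
    (measurable_potential μ s t N).comp (continuous_act_left _).measurable
  induction n generalizing v with
  | zero =>
    rw [convPow, lintegral_dirac' _ (hm v)]
    simp [act]
  | succ n ih =>
    rw [convPow_add, convPow_one, Measure.mconv, lintegral_map (hm v) measurable_mul,
      lintegral_prod_symm' (fun p : Mat d × Mat d => potential μ s t N (act (p.1 * p.2) v))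
        ((hm v).comp measurable_mul)]
    simp only [act_mul]
    calc _ ≤ ∫⁻ A, t ^ n * potential μ s t N (act A v) ∂μ := lintegral_mono fun A => ih (act A v)
      _ = t ^ n * ∫⁻ A, potential μ s t N (act A v) ∂μ := lintegral_const_mul _ (hm v)
      _ ≤ t ^ n * (t * potential μ s t N v) := by
          gcongr; exact lintegral_potential_act_le μ hs ht ht' hN h v
      _ = _ := by ring

/-- A Bochi-type inequality for moments of products of random matrices. -/
theorem moment_convPow_mul_le (d : ℕ) (hd : 1 ≤ d) (S : ℝ) :
    ∃ C : ℝ≥0∞, C ≠ ⊤ ∧ ∀ (μ : Measure (Mat d)) [IsProbabilityMeasure μ] (s : ℝ), 0 < s → s ≤ S →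
      (∀ n, moment (convPow μ n) s ≠ ⊤) →
      ∀ (t : ℝ≥0∞) (N : ℕ), t ≠ 0 → t ≠ ⊤ → 1 ≤ N → moment (convPow μ N) s ≤ t ^ N →
      ∀ n, moment (convPow μ (n * d)) s ≤
        C * t ^ n * moment (convPow μ n) s ^ (d - 1) := by
  by_cases hS0 : S ≤ 0
  · exact ⟨0, by simp, fun μ _ s hs hsS => by linarith⟩
  push Not at hS0
  set K : ℝ≥0∞ := 2 ^ S with hKdef
  set P : ℝ≥0∞ := 2 * (2 * (3 * K) ^ d) with hP
  set D : ℝ≥0∞ := (d : ℝ≥0∞) ^ S * d with hD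
  have hK : 1 ≤ K := ENNReal.one_le_rpow (by norm_num) hS0
  have hK' : K ≠ ⊤ := ENNReal.rpow_ne_top_of_nonneg hS0.le (by norm_num)
  have hD' : D ≠ ⊤ :=
    ENNReal.mul_ne_top (ENNReal.rpow_ne_top_of_nonneg hS0.le (by simp)) (by simp)
  have hP' : P ≠ ⊤ := by
    refine ENNReal.mul_ne_top (by norm_num) (ENNReal.mul_ne_top (by norm_num) ?_)
    exact ENNReal.pow_ne_top (ENNReal.mul_ne_top (by norm_num) hK')
  refine ⟨((d * d : ℕ) : ℝ≥0∞) ^ S * (((d * d : ℕ) : ℝ≥0∞) * (D ^ (d - 1) * P)), ?_, ?_⟩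
  · refine ENNReal.mul_ne_top
      (ENNReal.rpow_ne_top_of_nonneg hS0.le (ENNReal.natCast_ne_top _))
      (ENNReal.mul_ne_top (ENNReal.natCast_ne_top _)
        (ENNReal.mul_ne_top (ENNReal.pow_ne_top hD') hP'))
  intro μ _ s hs hsS hfin t N ht ht' hN h n
  set f := potential μ s t N
  have hffin : ∀ v, f v ≠ ⊤ := fun v =>
    ENNReal.sum_ne_top.2 fun m _ => ENNReal.mul_ne_top
      (ENNReal.pow_ne_top (ENNReal.inv_ne_top.2 ht))
      (ne_top_of_le_ne_top (ENNReal.mul_ne_top (hfin m)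
        (ENNReal.rpow_ne_top_of_nonneg hs.le enorm_ne_top)) (vectorMoment_le _ hs.le v))
  have hfsmul : ∀ (c : ℝ) v, f (c • v) = ‖c‖ₑ ^ s * f v := fun c v => by
    simp only [f, potential, vectorMoment_smul _ hs.le, Finset.mul_sum]
    exact Finset.sum_congr rfl fun m _ => by ring
  have hfadd : ∀ v w, f (v + w) ≤ K * (f v + f w) := fun v w => by
    simp only [f, potential, ← Finset.sum_add_distrib, Finset.mul_sum]
    refine Finset.sum_le_sum fun m _ => ?_
    rw [← mul_add, mul_left_comm]
    gcongr
    exact vectorMoment_add_le _ hs hsS v w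
  have hfpos := enorm_rpow_le_potential μ s t hN
  obtain ⟨b, hb1, hb2⟩ := exists_adapted_orthonormalBasis (d := d) (by simp) hs hK f hffin
    hfpos hfsmul hfadd
  have hentry : ∀ i j, j ≤ i → entryMoment b (convPow μ n) s i j ≤ P * t ^ n := by
    intro i j hji
    have hf0 : f (b i) ≠ 0 := by
      have := hfpos (b i)
      rw [← ofReal_norm, b.norm_eq_one, ENNReal.ofReal_one, ENNReal.one_rpow] at this
      exact (one_pos.trans_le this).ne'
    -- After multiplication by `f (b i)`, the coordinate bound `hb2` replaces the entry by `f (A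
    -- b_j)`, whose average is at most `t ^ n * f (b j)`; since `j ≤ i`, `hb1` returns to `f (b i)`,
    -- which cancels.
    rw [← ENNReal.mul_le_mul_iff_left hf0 (hffin _)]
    calc entryMoment b (convPow μ n) s i j * f (b i)
        = ∫⁻ A, ‖entry b i j A‖ₑ ^ s * f (b i) ∂(convPow μ n) :=
          (lintegral_mul_const _ (measurable_enorm_entry_rpow b s i j)).symm
      _ ≤ ∫⁻ A, 2 * (3 * K) ^ d * f (act A (b j)) ∂(convPow μ n) :=
          lintegral_mono fun A => hb2 i (act A (b j))
      _ = 2 * (3 * K) ^ d * ∫⁻ A, f (act A (b j)) ∂(convPow μ n) :=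
          lintegral_const_mul _ ((measurable_potential μ s t N).comp
            (continuous_act_left _).measurable)
      _ ≤ 2 * (3 * K) ^ d * (t ^ n * f (b j)) := by
          gcongr; exact lintegral_potential_convPow_le μ hs.le ht ht' hN h n (b j)
      _ ≤ 2 * (3 * K) ^ d * (t ^ n * (2 * f (b i))) := by
          gcongr; exact hb1 j i hji
      _ = P * t ^ n * f (b i) := by rw [hP]; ring
  have hd1 : d - 1 + 1 = d := by omega
  -- With `m = d - 1`, the condition `j ≤ i + m` holds for every pair of indices.
  have hmain : ∀ i j, entryMoment b (convPow (convPow μ n) d) s i j ≤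
      D ^ (d - 1) * (P * t ^ n) * moment (convPow μ n) s ^ (d - 1) := by
    intro i j
    have := entryMoment_convPow_le b (convPow μ n) hs hsS hentry (d - 1) i j
      (by have := j.2; omega)
    rwa [hd1] at this
  rw [← convPow_convPow]
  refine (moment_le_sum_entryMoment b _ hs hsS).trans ?_
  calc _ ≤ ((d * d : ℕ) : ℝ≥0∞) ^ S * ∑ _p : Fin d × Fin d,
        D ^ (d - 1) * (P * t ^ n) * moment (convPow μ n) s ^ (d - 1) := by
        exact mul_le_mul' le_rfl (Finset.sum_le_sum fun p _ => hmain p.1 p.2)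
    _ = _ := by
        rw [Finset.sum_const, Finset.card_univ, Fintype.card_prod, Fintype.card_fin,
          nsmul_eq_mul]
        ring

end Potential

/-! ### Fekete's lemma and growth rates in the extended reals. -/

section Fekete

lemma coe_le_div_log_iff {n : ℕ} (hn : 1 ≤ n) (c : ℝ) (x : ℝ≥0∞) :
    (c : EReal) ≤ ((1 / (n : ℝ) : ℝ) : EReal) * ENNReal.log x ↔
      ENNReal.ofReal (Real.exp c) ^ n ≤ x := by
  have h0 : (0 : EReal) < n := by exact_mod_cast hn
  have h1 : ((1 / (n : ℝ) : ℝ) : EReal) * ENNReal.log x = ENNReal.log x / n := by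
    rw [EReal.div_eq_inv_mul, one_div, EReal.coe_inv, EReal.coe_coe_eq_natCast]
  rw [h1, EReal.le_div_iff_mul_le h0 (EReal.natCast_ne_top n), ← ENNReal.log_le_log_iff,
    ENNReal.log_pow, ENNReal.log_ofReal_of_pos (Real.exp_pos c), Real.log_exp, mul_comm]

/-- The infimum of `(1 / n) log (u n)` over `n ≥ 1`. -/
noncomputable def growthRate (u : ℕ → ℝ≥0∞) : EReal :=
  ⨅ n : ℕ, ⨅ _ : 1 ≤ n, ((1 / (n : ℝ) : ℝ) : EReal) * ENNReal.log (u n)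

lemma coe_le_growthRate_iff (u : ℕ → ℝ≥0∞) (c : ℝ) :
    (c : EReal) ≤ growthRate u ↔ ∀ n, 1 ≤ n → ENNReal.ofReal (Real.exp c) ^ n ≤ u n := by
  simp only [growthRate, le_iInf_iff]
  exact forall₂_congr fun n hn => coe_le_div_log_iff hn c (u n)

lemma growthRate_lt_coe_iff (u : ℕ → ℝ≥0∞) (c : ℝ) :
    growthRate u < c ↔ ∃ n, 1 ≤ n ∧ u n < ENNReal.ofReal (Real.exp c) ^ n := by
  rw [← not_le, coe_le_growthRate_iff]
  push Not
  rfl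

/-- Fekete's lemma for submultiplicative sequences, with values in `[-∞, ∞)`. -/
lemma tendsto_growthRate (u : ℕ → ℝ≥0∞) (hu : ∀ m n, u (m + n) ≤ u m * u n)
    (hfin : ∀ n, u n ≠ ⊤) :
    Tendsto (fun n : ℕ => ((1 / (n : ℝ) : ℝ) : EReal) * ENNReal.log (u n)) atTop
      (𝓝 (growthRate u)) := by
  refine tendsto_order.2 ⟨fun a ha => ?_, fun a ha => ?_⟩
  · filter_upwards [eventually_ge_atTop 1] with n hn
    exact ha.trans_le (iInf₂_le n hn)
  · obtain ⟨c, hc, hca⟩ := EReal.lt_iff_exists_real_btwn.1 ha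
    suffices h : ∀ᶠ n : ℕ in atTop, u n < ENNReal.ofReal (Real.exp c) ^ n by
      filter_upwards [h, eventually_ge_atTop 1] with n hn hn1
      refine lt_trans ?_ hca
      rwa [← not_le, coe_le_div_log_iff hn1, not_le]
    obtain ⟨N, hN, hNc⟩ := (growthRate_lt_coe_iff u c).1 hc
    -- A zero value forces all later values to vanish. Otherwise the logarithms are real and form a
    -- subadditive sequence.
    by_cases h0 : ∃ m, u m = 0
    · obtain ⟨m, hm⟩ := h0
      filter_upwards [eventually_ge_atTop m] with n hn
      have : u n = 0 := by
        have := hu m (n - m)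
        rw [hm, zero_mul, Nat.add_sub_cancel' hn] at this
        exact le_antisymm this zero_le
      rw [this]
      exact ENNReal.pow_pos (ENNReal.ofReal_pos.2 (Real.exp_pos c)) n
    · push Not at h0
      have hpos : ∀ n, 0 < (u n).toReal := fun n => ENNReal.toReal_pos (h0 n) (hfin n)
      have hiff : ∀ n : ℕ, 1 ≤ n →
          (u n < ENNReal.ofReal (Real.exp c) ^ n ↔ Real.log (u n).toReal / n < c) := by
        intro n hn
        rw [div_lt_iff₀ (by exact_mod_cast hn), Real.log_lt_iff_lt_exp (hpos n),
          ← ENNReal.ofReal_pow (Real.exp_pos c).le, ← Real.exp_nat_mul, mul_comm c,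
          ENNReal.lt_ofReal_iff_toReal_lt (hfin n)]
      have hsub : Subadditive fun n => Real.log (u n).toReal := by
        intro m n
        rw [← Real.log_mul (hpos m).ne' (hpos n).ne', ← ENNReal.toReal_mul]
        exact Real.log_le_log (hpos _)
          (ENNReal.toReal_mono (ENNReal.mul_ne_top (hfin m) (hfin n)) (hu m n))
      filter_upwards [hsub.eventually_div_lt_of_div_lt (by omega) ((hiff N hN).1 hNc),
        eventually_ge_atTop 1] with n hn hn1
      exact (hiff n hn1).2 hn

/-- If `u` grows at rate `r > c`, then `u (n * d)` dominates `e ^ (c n) * u n ^ (d - 1)` by an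
arbitrarily large factor for some `n`. -/
lemma exists_mul_lt_of_lt_growthRate (u : ℕ → ℝ≥0∞) (hu : ∀ m n, u (m + n) ≤ u m * u n)
    (hone : ∀ n, u n ≤ 1) {c : ℝ} (hc : (c : EReal) < growthRate u) {d : ℕ} (hd : 1 ≤ d)
    {C : ℝ≥0∞} (hC : C ≠ ⊤) :
    ∃ n, C * ENNReal.ofReal (Real.exp c) ^ n * u n ^ (d - 1) < u (n * d) := by
  have hfin : ∀ n, u n ≠ ⊤ := fun n => ne_top_of_le_ne_top ENNReal.one_ne_top (hone n)
  obtain ⟨L, hL⟩ : ∃ L : ℝ, growthRate u = L := by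
    have h1 : growthRate u ≠ ⊥ := (bot_le.trans_lt hc).ne'
    have h2 : growthRate u ≠ ⊤ := by
      refine ne_top_of_le_ne_top EReal.zero_ne_top (le_trans (iInf₂_le 1 le_rfl) ?_)
      simpa using hone 1
    exact ⟨_, (EReal.coe_toReal h2 h1).symm⟩
  rw [hL, EReal.coe_lt_coe_iff] at hc
  have hdpos : (0 : ℝ) < d := by exact_mod_cast hd
  -- The exponents per unit of `n` are `d * L` for the lower bound on `u (n * d)` and `c + (d - 1) *
  -- (L + ε)` for the other side. Since `L - c = 2 * d * ε`, the gap is at least `ε * d`, and `e ^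
  -- (n ε d)` eventually beats `C`.
  set ε := (L - c) / (2 * d) with hε
  have hεpos : 0 < ε := div_pos (by linarith) (by positivity)
  have hlow := (coe_le_growthRate_iff u L).1 hL.ge
  have hup : ∀ᶠ n : ℕ in atTop, u n < ENNReal.ofReal (Real.exp (L + ε)) ^ n := by
    have h := (tendsto_growthRate u hu hfin).eventually_lt_const
      (show growthRate u < ((L + ε : ℝ) : EReal) by
        rw [hL, EReal.coe_lt_coe_iff]; linarith)
    filter_upwards [h, eventually_ge_atTop 1] with n hn hn1
    rwa [← not_le, coe_le_div_log_iff hn1, not_le] at hn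
  have hexp : ∀ᶠ n : ℕ in atTop, C < ENNReal.ofReal (Real.exp (n * (ε * d))) := by
    have h : Tendsto (fun n : ℕ => Real.exp (n * (ε * d))) atTop atTop :=
      Real.tendsto_exp_atTop.comp
        (tendsto_natCast_atTop_atTop.atTop_mul_const (mul_pos hεpos hdpos))
    filter_upwards [h.eventually_gt_atTop C.toReal] with n hn
    rwa [ENNReal.lt_ofReal_iff_toReal_lt hC]
  obtain ⟨n, h1, h2, h3⟩ := (hup.and (hexp.and (eventually_ge_atTop 1))).exists
  refine ⟨n, ?_⟩
  have hpow : ∀ (x : ℝ) (k : ℕ),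
      ENNReal.ofReal (Real.exp x) ^ k = ENNReal.ofReal (Real.exp (k * x)) := fun x k => by
    rw [← ENNReal.ofReal_pow (Real.exp_pos x).le, ← Real.exp_nat_mul]
  have hcast : ((d - 1 : ℕ) : ℝ) = d - 1 := by push_cast [hd]; ring
  have hεd : 2 * (ε * d) = L - c := by rw [hε]; field_simp
  calc C * ENNReal.ofReal (Real.exp c) ^ n * u n ^ (d - 1)
      ≤ C * ENNReal.ofReal (Real.exp c) ^ n *
          (ENNReal.ofReal (Real.exp (L + ε)) ^ n) ^ (d - 1) := by gcongr
    _ = C * ENNReal.ofReal (Real.exp (n * c + n * ((d - 1) * (L + ε)))) := by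
        rw [hpow, hpow, hpow, mul_assoc, ← ENNReal.ofReal_mul (Real.exp_pos _).le,
          ← Real.exp_add, hcast]
        congr 4; ring
    _ < ENNReal.ofReal (Real.exp (n * (ε * d))) *
          ENNReal.ofReal (Real.exp (n * c + n * ((d - 1) * (L + ε)))) :=
        ENNReal.mul_lt_mul_left (ENNReal.ofReal_pos.2 (Real.exp_pos _)).ne' ENNReal.ofReal_ne_top h2
    _ ≤ ENNReal.ofReal (Real.exp L) ^ (n * d) := by
        rw [hpow, ← ENNReal.ofReal_mul (Real.exp_pos _).le, ← Real.exp_add]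
        refine ENNReal.ofReal_le_ofReal (Real.exp_le_exp.2 ?_)
        push_cast
        have : ε * d + c + (d - 1) * (L + ε) ≤ d * L := by nlinarith
        calc _ = n * (ε * d + c + (d - 1) * (L + ε)) := by ring
          _ ≤ n * (d * L) := by gcongr
          _ = _ := by ring
    _ ≤ u (n * d) := hlow _ (Nat.mul_pos h3 hd)

end Fekete

/-! ### Joint continuity of the moments and of the pressure. -/

section Continuity

/-- Changing the integrand costs at most the sup norm of the change, uniformly over probability
measures, so weak convergence is needed only for the fixed function `g₀`. -/
lemma continuous_integral_probabilityMeasure_prod {X : Type*} [TopologicalSpace X]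
    [CompactSpace X] [MeasurableSpace X] [OpensMeasurableSpace X] :
    Continuous fun p : ProbabilityMeasure X × C(X, ℝ) => ∫ x, p.2 x ∂(p.1 : Measure X) := by
  refine continuous_iff_continuousAt.2 fun ⟨ν₀, g₀⟩ => ?_
  have hint : ∀ (ν : ProbabilityMeasure X) (g : C(X, ℝ)), Integrable g (ν : Measure X) :=
    fun ν g => (BoundedContinuousFunction.mkOfCompact g).integrable _
  have h1 : Tendsto (fun p : ProbabilityMeasure X × C(X, ℝ) => ∫ x, g₀ x ∂(p.1 : Measure X))
      (𝓝 (ν₀, g₀)) (𝓝 (∫ x, g₀ x ∂(ν₀ : Measure X))) :=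
    ((ProbabilityMeasure.tendsto_iff_forall_integral_tendsto.1 tendsto_id)
      (BoundedContinuousFunction.mkOfCompact g₀)).comp continuous_fst.continuousAt
  have h2 : Tendsto (fun p : ProbabilityMeasure X × C(X, ℝ) =>
      ∫ x, (p.2 - g₀) x ∂(p.1 : Measure X)) (𝓝 (ν₀, g₀)) (𝓝 0) := by
    refine squeeze_zero_norm (a := fun p => ‖p.2 - g₀‖) (fun p => ?_) ?_
    · refine (norm_integral_le_of_norm_le_const (C := ‖p.2 - g₀‖)
        (Eventually.of_forall fun x => (p.2 - g₀).norm_coe_le_norm x)).trans_eq ?_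
      simp
    · have h : Continuous fun p : ProbabilityMeasure X × C(X, ℝ) => ‖p.2 - g₀‖ := by fun_prop
      simpa using h.tendsto (ν₀, g₀)
  have h3 := h1.add h2
  rw [add_zero] at h3
  refine h3.congr fun p => ?_
  rw [← integral_add (hint _ _) (hint _ _)]
  simp

variable {d : ℕ}

instance (μ : BallMeasure d) : IsProbabilityMeasure μ.extend :=
  Measure.isProbabilityMeasure_map measurable_subtype_coe.aemeasurable

/-- The function `(s, A₁, …, Aₙ) ↦ ‖A₁ ⋯ Aₙ‖ ^ s` on the unit ball. -/
noncomputable def normProdRpow (d n : ℕ) :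
    C(Set.Ioi (0 : ℝ) × (Fin n → UnitBall d), ℝ) where
  toFun p := ‖(List.ofFn fun i => (p.2 i : Mat d)).prod‖ ^ (p.1 : ℝ)
  continuous_toFun := by
    -- The product may vanish, so continuity of the power relies on a positive exponent.
    refine Continuous.rpow ?_ (by fun_prop) fun p => Or.inr p.1.2
    exact ((continuous_ofFn_prod n).comp (by fun_prop)).norm

lemma normMoment_extend (μ : BallMeasure d) (s : Set.Ioi (0 : ℝ)) (n : ℕ) :
    normMoment μ.extend s n =
      ENNReal.ofReal (∫ A, (normProdRpow d n).curry s A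
        ∂(ProbabilityMeasure.pi fun _ : Fin n => μ : Measure (Fin n → UnitBall d))) := by
  have hpi : Measure.pi (fun _ : Fin n => μ.extend) =
      (Measure.pi fun _ : Fin n => (μ : Measure (UnitBall d))).map
        fun A i => (A i : Mat d) :=
    (Measure.pi_map_pi fun _ => measurable_subtype_coe.aemeasurable).symm
  have hm : Measurable fun A : Fin n → Mat d => ENNReal.ofReal (‖(List.ofFn A).prod‖ ^ (s : ℝ)) :=
    ((continuous_ofFn_prod n).norm.measurable.pow_const _).ennreal_ofReal
  rw [normMoment, hpi, lintegral_map hm (by fun_prop), ofReal_integral_eq_lintegral_ofReal]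
  · rfl
  · exact (BoundedContinuousFunction.mkOfCompact ((normProdRpow d n).curry s)).integrable _
  · exact Eventually.of_forall fun A => Real.rpow_nonneg (norm_nonneg _) _

/-- Currying makes the integrand a sup-norm continuous function of the exponent, and the product
measure depends weakly continuously on `μ`. -/
lemma continuous_normMoment (n : ℕ) :
    Continuous fun p : BallMeasure d × Set.Ioi (0 : ℝ) => normMoment p.1.extend p.2 n := by
  simp only [normMoment_extend]
  refine ENNReal.continuous_ofReal.comp
    (continuous_integral_probabilityMeasure_prod.comp (Continuous.prodMk ?_ ?_))
  · exact ProbabilityMeasure.continuous_pi.comp (continuous_pi fun _ => continuous_fst)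
  · exact (normProdRpow d n).curry.continuous.comp continuous_snd

lemma moment_extend_le_one (μ : BallMeasure d) {s : ℝ} (hs : 0 ≤ s) : moment μ.extend s ≤ 1 := by
  rw [moment, BallMeasure.extend,
    lintegral_map (measurable_enorm_rpow s) measurable_subtype_coe]
  calc _ ≤ ∫⁻ _ : UnitBall d, 1 ∂(μ : Measure (UnitBall d)) := by
        refine lintegral_mono fun A => ENNReal.rpow_le_one ?_ hs
        rw [← ofReal_norm]
        exact ENNReal.ofReal_le_one.2 (mem_closedBall_zero_iff.1 A.2)
    _ = 1 := by simp

lemma normMoment_add_le (μ : BallMeasure d) {s : ℝ} (hs : 0 ≤ s) (m n : ℕ) :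
    normMoment μ.extend s (m + n) ≤ normMoment μ.extend s m * normMoment μ.extend s n := by
  simpa only [normMoment_eq_moment _ hs] using moment_convPow_add_le μ.extend hs m n

lemma normMoment_le_one (hd : 1 ≤ d) (μ : BallMeasure d) {s : ℝ} (hs : 0 ≤ s) (n : ℕ) :
    normMoment μ.extend s n ≤ 1 := by
  induction n with
  | zero =>
    have : Nonempty (Fin d) := ⟨⟨0, hd⟩⟩
    simp [normMoment]
  | succ n ih =>
    rw [add_comm]
    refine (normMoment_add_le μ hs 1 n).trans (mul_le_one' ?_ ih)
    rw [normMoment_eq_moment _ hs, convPow_one]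
    exact moment_extend_le_one μ hs

lemma tendsto_pressureSeq (hd : 1 ≤ d) (μ : BallMeasure d) {s : ℝ} (hs : 0 ≤ s) :
    Tendsto (pressureSeq μ.extend s) atTop (𝓝 (growthRate (normMoment μ.extend s))) :=
  tendsto_growthRate _ (normMoment_add_le μ hs) fun n =>
    ne_top_of_le_ne_top ENNReal.one_ne_top (normMoment_le_one hd μ hs n)

lemma pressure_eq_growthRate (hd : 1 ≤ d) (μ : BallMeasure d) {s : ℝ} (hs : 0 ≤ s) :
    pressure μ.extend s = growthRate (normMoment μ.extend s) :=
  (tendsto_pressureSeq hd μ hs).limUnder_eq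

lemma pressure_lt_top (hd : 1 ≤ d) (μ : BallMeasure d) {s : ℝ} (hs : 0 ≤ s) :
    pressure μ.extend s < ⊤ := by
  rw [pressure_eq_growthRate hd μ hs]
  refine lt_of_le_of_lt ((iInf₂_le 1 le_rfl).trans ?_) EReal.zero_lt_top
  simpa using normMoment_le_one hd μ hs 1

lemma continuous_pressure (hd : 1 ≤ d) :
    Continuous fun p : BallMeasure d × Set.Ioi (0 : ℝ) => pressure p.1.extend (p.2 : ℝ) := by
  have heq : ∀ p : BallMeasure d × Set.Ioi (0 : ℝ),
      pressure p.1.extend (p.2 : ℝ) = growthRate (normMoment p.1.extend p.2) := fun p =>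
    pressure_eq_growthRate hd p.1 (le_of_lt p.2.2)
  simp only [heq]
  refine continuous_iff_continuousAt.2 fun p₀ => tendsto_order.2 ⟨fun a ha => ?_, fun a ha => ?_⟩
  -- Lower semicontinuity. The bound `s₀ + 1` on the exponents fixes one constant `C` valid on a
  -- whole neighbourhood of `p₀`.
  · obtain ⟨c, hac, hc⟩ := EReal.lt_iff_exists_real_btwn.1 ha
    obtain ⟨C, hC, hbound⟩ := moment_convPow_mul_le d hd ((p₀.2 : ℝ) + 1)
    have hs₀ : (0 : ℝ) ≤ p₀.2 := le_of_lt p₀.2.2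
    obtain ⟨n, hn⟩ := exists_mul_lt_of_lt_growthRate _ (normMoment_add_le p₀.1 hs₀)
      (normMoment_le_one hd p₀.1 hs₀) hc hd hC
    have hK : C * ENNReal.ofReal (Real.exp c) ^ n ≠ ⊤ :=
      ENNReal.mul_ne_top hC (ENNReal.pow_ne_top ENNReal.ofReal_ne_top)
    have hev : ∀ᶠ p : BallMeasure d × Set.Ioi (0 : ℝ) in 𝓝 p₀,
        C * ENNReal.ofReal (Real.exp c) ^ n * normMoment p.1.extend p.2 n ^ (d - 1) <
          normMoment p.1.extend p.2 (n * d) :=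
      (((ENNReal.continuous_const_mul hK).comp
        ((ENNReal.continuous_pow _).comp (continuous_normMoment n))).tendsto p₀).eventually_lt
        ((continuous_normMoment (n * d)).tendsto p₀) hn
    have hs : ∀ᶠ p : BallMeasure d × Set.Ioi (0 : ℝ) in 𝓝 p₀, (p.2 : ℝ) < p₀.2 + 1 :=
      ((continuous_subtype_val.comp continuous_snd).tendsto p₀).eventually_lt_const
        (lt_add_one _)
    filter_upwards [hev, hs] with p hp hps
    have hp0 : (0 : ℝ) < p.2 := p.2.2
    refine hac.trans_le ((coe_le_growthRate_iff _ c).2 fun N hN => ?_)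
    -- One `N` violating the bound would trigger the Bochi-type inequality with `t = e ^ c`,
    -- contradicting the strict inequality `hp`.
    by_contra! hlt
    refine hp.not_ge ?_
    have h := hbound p.1.extend p.2 hp0 hps.le
    simp only [← normMoment_eq_moment p.1.extend hp0.le] at h
    exact h (fun m => ne_top_of_le_ne_top ENNReal.one_ne_top (normMoment_le_one hd p.1 hp0.le m))
      _ N (ENNReal.ofReal_pos.2 (Real.exp_pos c)).ne' ENNReal.ofReal_ne_top hN hlt.le n
  -- Upper semicontinuity: a single `n` witnesses that the infimum lies below `c`, and it remains a
  -- witness nearby.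
  · obtain ⟨c, hc, hca⟩ := EReal.lt_iff_exists_real_btwn.1 ha
    obtain ⟨n, hn, hlt⟩ := (growthRate_lt_coe_iff _ c).1 hc
    filter_upwards [((continuous_normMoment n).tendsto p₀).eventually_lt_const hlt] with p hp
    exact ((growthRate_lt_coe_iff _ c).2 ⟨n, hn, hp⟩).trans hca

end Continuity

end NormPressure

theorem mainTheorem2 (d : ℕ) (hd : 1 ≤ d) :
    (∀ (μ : NormPressure.BallMeasure d) (s : ℝ), 0 < s →
      Tendsto (NormPressure.pressureSeq μ.extend s) atTop
        (𝓝 (NormPressure.pressure μ.extend s))) ∧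
    ∃ h : ∀ p : NormPressure.BallMeasure d × Set.Ioi (0 : ℝ),
        NormPressure.pressure p.1.extend (p.2 : ℝ) ∈ Set.Iio (⊤ : EReal),
      Continuous (fun p : NormPressure.BallMeasure d × Set.Ioi (0 : ℝ) =>
        (⟨NormPressure.pressure p.1.extend (p.2 : ℝ), h p⟩ : Set.Iio (⊤ : EReal))) := by
  refine ⟨fun μ s hs => ?_, fun p => NormPressure.pressure_lt_top hd p.1 (le_of_lt p.2.2),
    (NormPressure.continuous_pressure hd).subtype_mk _⟩
  rw [NormPressure.pressure_eq_growthRate hd μ hs.le]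
  exact NormPressure.tendsto_pressureSeq hd μ hs.le
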